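/- For $\bar\gamma>0$, $\kappa\ge 0$, $\mu>0$, $m>0$, a random variable $\gamma$ is called $\kappa$-$\mu$ shadowed, written $\gamma\sim\mathcal S_{\kappa\mu}(\bar\gamma;\kappa,\mu,m)$, if its law has density $x\mapsto\int_0^\infty f(x\mid\xi)\,f_\xi(\xi)\,d\xi$ on $(0,\infty)$ and no mass elsewhere, where $f_\xi(\xi)=\frac{2m^m}{\Gamma(m)}\xi^{2m-1}e^{-m\xi^2}$ is the Nakagami-$m$ density with $E[\xi^2]=1$, and $$f(x\mid\xi)=\frac{\mu(1+\kappa)^{\frac{\mu+1}{2}}}{\bar\gamma\,\kappa^{\frac{\mu-1}{2}}e^{\xi^2\mu\kappa}}\left(\frac{x}{\xi^2\bar\gamma}\right)^{\frac{\mu-1}{2}}e^{-\frac{\mu(1+\kappa)x}{\bar\gamma}}\,I_{\mu-1}\!\left(2\mu\xi\sqrt{\frac{\kappa(1+\kappa)x}{\bar\gamma}}\right)$$ is the $\kappa$-$\mu$ density, $I_\nu$ being the modified Bessel function of the first kind; for $\kappa=0$, $f(x\mid\xi)$ is understood as its limit as $\kappa\to0^+$, the Gamma density with shape $\mu$ and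 mean $\bar\gamma$. For $N\ge1$ let $$\Phi_2^{(N)}(b_1,\dots,b_N;c;x_1,\dots,x_N)=\sum_{n_1,\dots,n_N\ge0}\frac{(b_1)_{n_1}\cdots(b_N)_{n_N}}{(c)_{n_1+\cdots+n_N}}\,\frac{x_1^{n_1}\cdots x_N^{n_N}}{n_1!\cdots n_N!}$$ be the confluent multivariate hypergeometric function, where $(a)_n=a(a+1)\cdots(a+n-1)$. Let $M\ge1$ and let $\gamma_k\sim\mathcal S_{\kappa\mu}(\bar\gamma_k;\kappa_k,\mu_k,m_k)$, $k=1,\dots,M$, be mutually independent, with arbitrary parameters $\bar\gamma_k>0$, $\kappa_k\ge0$, $\mu_k>0$, $m_k>0$. Put $\gamma=\sum_{k=1}^M\gamma_k$, $S=\sum_{k=1}^M\mu_k$ and $$C=\prod_{k=1}^M\frac{\mu_k^{\mu_k}m_k^{m_k}(1+\kappa_k)^{\mu_k}}{(\mu_k\kappa_k+m_k)^{m_k}}\left(\frac1{\bar\gamma_k}\right)^{\mu_k},$$ and for real $x$ and $c>0$ put $$\Psi_c(x)=\Phi_2^{(2M)}\Big(\mu_1-m_1,\dots,\mu_M-m_M,m_1,\dots,m_M;\,c;\,-\tfrac{\mu_1(1+\kappa_1)x}{\bar\gamma_1},\dots,-\tfrac{\mu_M(1+\kappa_M)x}{\bar\gamma_M},\,-\tfrac{\mu_1(1+\kappa_1)}{\bar\gamma_1}\tfrac{m_1x}{\mu_1\kappa_1+m_1},\dots,-\tfrac{\mu_M(1+\kappa_M)}{\bar\gamma_M}\tfrac{m_Mx}{\mu_M\kappa_M+m_M}\Big).$$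 Then the series defining $\Psi_S(x)$ and $\Psi_{1+S}(x)$ converge absolutely for every real $x$; the law of $\gamma$ is absolutely continuous, with nonnegative density $$f_\gamma(x)=\frac{C}{\Gamma(S)}\,x^{S-1}\,\Psi_S(x)\quad(x>0),\qquad f_\gamma(x)=0\quad(x\le0);$$ and its cumulative distribution function is $$F_\gamma(x)=\frac{C}{\Gamma(1+S)}\,x^{S}\,\Psi_{1+S}(x)\quad(x\ge0),\qquad F_\gamma(x)=0\quad(x<0).$$ -/

import Mathlib

open MeasureTheory ProbabilityTheory

noncomputable section

namespace KappaMu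

/-- The modified Bessel function of the first kind `I_ν(z)` of real order `ν`, at real `z ≥ 0`:
`I_ν(z) = ∑_j (z/2)^(2j+ν) / (j! Γ(j+ν+1))`. -/
def besselI (ν z : ℝ) : ℝ :=
  ∑' j : ℕ, (z / 2) ^ (2 * (j : ℝ) + ν) / ((j.factorial : ℝ) * Real.Gamma ((j : ℝ) + ν + 1))

/-- The density of a Nakagami-`m` random variable `ξ` normalized by `E[ξ²] = 1`. -/
def nakagamiPDF (m ξ : ℝ) : ℝ :=
  if 0 < ξ then
    2 * m ^ m / Real.Gamma m * ξ ^ (2 * m - 1) * Real.exp (-(m * ξ ^ 2))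
  else 0

/-- The conditional density of the instantaneous SNR given the shadowing amplitude `ξ`, that is
the `κ`-`μ` density with dominant components multiplied by `ξ` (mean SNR `gbar` when `ξ = 1`).
For `κ = 0` (no dominant components) the general expression is an indeterminate form; its limit
as `κ → 0` is the Gamma density of shape `μ` and mean `gbar`. -/
def kappaMuCondPDF (gbar κ μ ξ x : ℝ) : ℝ :=
  if 0 < x then
    if κ = 0 then gammaPDFReal μ (μ / gbar) x
    else
      μ * (1 + κ) ^ ((μ + 1) / 2) / (gbar * κ ^ ((μ - 1) / 2) * Real.exp (ξ ^ 2 * μ * κ))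
        * (x / (ξ ^ 2 * gbar)) ^ ((μ - 1) / 2)
        * Real.exp (-(μ * (1 + κ) * x / gbar))
        * besselI (μ - 1) (2 * μ * ξ * Real.sqrt (κ * (1 + κ) * x / gbar))
  else 0

/-- The `κ`-`μ` shadowed distribution with mean `gbar` and shaping parameters `κ`, `μ`, `m`:
the mixture of the `κ`-`μ` laws given `ξ`, over the Nakagami-`m` shadowing amplitude `ξ`.
Its density at `x` is `∫_0^∞ f(x | ξ) f_ξ(ξ) dξ`. -/
def kappaMuShadowed (gbar κ μ m : ℝ) : Measure ℝ :=
  volume.withDensity fun x =>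
    ∫⁻ ξ in Set.Ioi (0 : ℝ),
      ENNReal.ofReal (kappaMuCondPDF gbar κ μ ξ x) * ENNReal.ofReal (nakagamiPDF m ξ)

/-- The rising factorial (Pochhammer symbol) `(a)_n = a (a+1) ⋯ (a+n-1)`. -/
def poch (a : ℝ) (n : ℕ) : ℝ := (ascPochhammer ℝ n).eval a

/-- The term of multi-index `n` of the series of the confluent multivariate hypergeometric
function `Φ₂`, with variables indexed by the finite type `ι`:
`(∏_i (b_i)_{n_i} x_i^{n_i} / n_i!) / (c)_{n_1 + ⋯ + n_N}`. -/
def phi2Term {ι : Type*} [Fintype ι] (b : ι → ℝ) (c : ℝ) (x : ι → ℝ) (n : ι → ℕ) : ℝ :=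
  (∏ i, poch (b i) (n i) * x i ^ n i / ((n i).factorial : ℝ)) / poch c (∑ i, n i)

/-- The confluent multivariate hypergeometric function
`Φ₂^(N)(b_1, …, b_N; c; x_1, …, x_N)`, the sum of its multiple power series over all
multi-indices; here `N` is the cardinality of `ι`. -/
def phi2 {ι : Type*} [Fintype ι] (b : ι → ℝ) (c : ℝ) (x : ι → ℝ) : ℝ :=
  ∑' n : ι → ℕ, phi2Term b c x n

/-- The `2N` numerator parameters `(μ_1 - m_1, …, μ_N - m_N, m_1, …, m_N)`. -/
def sumParam {ι : Type*} (μ m : ι → ℝ) : ι ⊕ ι → ℝ :=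
  Sum.elim (fun k => μ k - m k) (fun k => m k)

/-- The `2N` arguments at `x`: first `-μ_k (1 + κ_k) x / gbar_k`, then
`-μ_k (1 + κ_k) / gbar_k * (m_k x / (μ_k κ_k + m_k))`, for `k = 1, …, N`. -/
def sumArg {ι : Type*} (gbar κ μ m : ι → ℝ) (x : ℝ) : ι ⊕ ι → ℝ :=
  Sum.elim (fun k => -(μ k * (1 + κ k) * x) / gbar k)
    (fun k => -(μ k * (1 + κ k)) / gbar k * (m k * x / (μ k * κ k + m k)))

/-- The constant
`∏_k (μ_k^μ_k m_k^m_k (1 + κ_k)^μ_k / (μ_k κ_k + m_k)^m_k) (1 / gbar_k)^μ_k`. -/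
def sumConst {ι : Type*} [Fintype ι] (gbar κ μ m : ι → ℝ) : ℝ :=
  ∏ k, (μ k ^ μ k * m k ^ m k * (1 + κ k) ^ μ k / (μ k * κ k + m k) ^ m k * (1 / gbar k) ^ μ k)

/-- The closed form for the density of the sum, at `x > 0`. -/
def sumPDF {ι : Type*} [Fintype ι] (gbar κ μ m : ι → ℝ) (x : ℝ) : ℝ :=
  (1 / Real.Gamma (∑ k, μ k)) * sumConst gbar κ μ m * x ^ ((∑ k, μ k) - 1)
    * phi2 (sumParam μ m) (∑ k, μ k) (sumArg gbar κ μ m x)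

/-- The closed form for the cumulative distribution function of the sum, at `x ≥ 0`. -/
def sumCDF {ι : Type*} [Fintype ι] (gbar κ μ m : ι → ℝ) (x : ℝ) : ℝ :=
  (1 / Real.Gamma (1 + ∑ k, μ k)) * sumConst gbar κ μ m * x ^ (∑ k, μ k)
    * phi2 (sumParam μ m) (1 + ∑ k, μ k) (sumArg gbar κ μ m x)

end KappaMu

end

namespace KappaMu

open PowerSeries Finset

/-! ### Sums grouped by degree -/

/-! The Laplace transform of a `κ`-`μ` shadowed law is `p ^ (-μ) a(1/p)`, where `a(X)` is a constant
times `(1 - r X)^(-(μ-m)) (1 - r' X)^(-m)`. Independent sums multiply transforms, so the orders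
`μ_k` add and the series `a_k` multiply; expanding the product of the `2M` binomial series by
multi-indices gives `Φ₂`.

The proof works in the time domain. `rlSeries s a` replaces `X ^ n` by the kernel `x ^ (s+n-1) /
Γ(s+n)`. The beta integral makes these kernels a convolution semigroup, whence `rlSeries_conv`:
convolution adds orders and multiplies series. Geometric bounds on coefficients suffice for
convergence, since `Γ(s+n)` outgrows every geometric sequence. The distribution function is the
convolution with the unit step, the kernel of order 1, so it only raises the order by one
(`rlMeasure_Iic`).

For one variable (`kappaMuShadowed_eq`), the Bessel series exhibits the law given `ξ` as a Poisson
mixture of Gamma laws. Averaging over `ξ` makes the weights negative binomial, and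
`hasSum_binomial_mixture` sums this mixture in closed form. -/

/-- Summation of a family by the fibers of a degree map with finite fibers. -/
theorem hasSum_of_grading {α : Type*} (d : α → ℕ) (A : ℕ → Finset α)
    (hA : ∀ a N, a ∈ A N ↔ d a = N) (g : α → ℝ) (h : Summable fun N => ∑ a ∈ A N, |g a|) :
    Summable g ∧ HasSum g (∑' N, ∑ a ∈ A N, g a) := by
  let e : (Σ N, A N) ≃ α :=
    { toFun := fun p => p.2
      invFun := fun a => ⟨d a, a, (hA a _).2 rfl⟩
      left_inv := by
        rintro ⟨N, a, ha⟩
        obtain rfl := (hA a N).1 ha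
        rfl
      right_inv := fun a => rfl }
  have hs : Summable (fun p : Σ N, A N => |g (e p)|) := by
    refine (summable_sigma_of_nonneg fun _ => abs_nonneg _).2 ⟨fun N => ?_, ?_⟩
    · exact Summable.of_finite
    · refine h.congr fun N => ?_
      rw [tsum_fintype]
      exact (Finset.sum_coe_sort (A N) (fun a => |g a|)).symm
  have hs' : Summable (fun p : Σ N, A N => g (e p)) := hs.of_abs
  have hg : Summable g := e.summable_iff.1 hs'
  refine ⟨hg, ?_⟩
  have h1 : ∑' a, g a = ∑' p, g (e p) := (e.tsum_eq g).symm
  have h2 : ∑' p, g (e p) = ∑' N, ∑ a ∈ A N, g a := by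
    rw [hs'.tsum_sigma]
    refine tsum_congr fun N => ?_
    rw [tsum_fintype]
    exact Finset.sum_coe_sort (A N) g
  rw [← h2, ← h1]
  exact hg.hasSum

/-! ### Power series with geometrically bounded coefficients -/

/-- The coefficients grow at most geometrically. -/
def GeomBound (a : PowerSeries ℝ) : Prop :=
  ∃ K R : ℝ, 0 ≤ K ∧ 0 ≤ R ∧ ∀ n, |coeff n a| ≤ K * R ^ n

/-- The power series of the absolute values of the coefficients. -/
noncomputable def absSeries (a : PowerSeries ℝ) : PowerSeries ℝ :=
  PowerSeries.mk fun n => |coeff n a|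

theorem coeff_absSeries (a : PowerSeries ℝ) (n : ℕ) : coeff n (absSeries a) = |coeff n a| := by
  simp [absSeries]

theorem GeomBound.absSeries {a : PowerSeries ℝ} (h : GeomBound a) : GeomBound (absSeries a) := by
  obtain ⟨K, R, hK, hR, h⟩ := h
  exact ⟨K, R, hK, hR, fun n => by rw [coeff_absSeries, abs_abs]; exact h n⟩

theorem GeomBound.mul {a b : PowerSeries ℝ} (ha : GeomBound a) (hb : GeomBound b) :
    GeomBound (a * b) := by
  obtain ⟨K, R, hK, hR, ha⟩ := ha
  obtain ⟨L, T, hL, hT, hb⟩ := hb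
  -- The factor 2 absorbs the `n + 1` terms of the antidiagonal, as `n + 1 ≤ 2 ^ n`.
  refine ⟨K * L, 2 * max R T, by positivity, by positivity, fun n => ?_⟩
  rw [PowerSeries.coeff_mul]
  calc |∑ p ∈ antidiagonal n, coeff p.1 a * coeff p.2 b|
      ≤ ∑ p ∈ antidiagonal n, |coeff p.1 a * coeff p.2 b| := Finset.abs_sum_le_sum_abs _ _
    _ ≤ ∑ p ∈ antidiagonal n, K * L * max R T ^ n := by
        refine Finset.sum_le_sum fun p hp => ?_
        rw [abs_mul, ← mem_antidiagonal.1 hp, pow_add]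
        calc |coeff p.1 a| * |coeff p.2 b| ≤ (K * R ^ p.1) * (L * T ^ p.2) := by
              gcongr
              · exact ha _
              · exact hb _
          _ ≤ (K * max R T ^ p.1) * (L * max R T ^ p.2) := by
              gcongr
              · exact le_max_left _ _
              · exact le_max_right _ _
          _ = _ := by ring
    _ = (n + 1) * (K * L * max R T ^ n) := by simp
    _ ≤ 2 ^ n * (K * L * max R T ^ n) := by
        gcongr
        exact_mod_cast Nat.lt_two_pow_self
    _ = K * L * (2 * max R T) ^ n := by rw [mul_pow]; ring

theorem GeomBound.one : GeomBound 1 := by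
  refine ⟨1, 1, by norm_num, by norm_num, fun n => ?_⟩
  rw [PowerSeries.coeff_one]
  split_ifs <;> simp

theorem GeomBound.C (r : ℝ) : GeomBound (PowerSeries.C r) := by
  refine ⟨|r|, 1, abs_nonneg _, by norm_num, fun n => ?_⟩
  rw [PowerSeries.coeff_C]
  split_ifs <;> simp

theorem GeomBound.prod {ι : Type*} (s : Finset ι) {a : ι → PowerSeries ℝ}
    (h : ∀ i ∈ s, GeomBound (a i)) : GeomBound (∏ i ∈ s, a i) := by
  classical
  induction s using Finset.induction_on with
  | empty => simpa using GeomBound.one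
  | insert i s hi ih =>
    rw [Finset.prod_insert hi]
    exact (h i (mem_insert_self _ _)).mul (ih fun j hj => h j (mem_insert_of_mem hj))

/-! ### The binomial series `(1 - r X)^(-b)` -/

theorem poch_zero (b : ℝ) : poch b 0 = 1 := by simp [poch]

theorem poch_succ (b : ℝ) (n : ℕ) : poch b (n + 1) = poch b n * (b + n) := by
  simp [poch, ascPochhammer_succ_eval]

theorem poch_pos {b : ℝ} (hb : 0 < b) (n : ℕ) : 0 < poch b n := ascPochhammer_pos n b hb

theorem poch_add (b : ℝ) (j n : ℕ) : poch b (j + n) = poch b j * poch (b + j) n := by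
  induction n with
  | zero => simp [poch_zero]
  | succ n ih => rw [← add_assoc, poch_succ, ih, poch_succ]; push_cast; ring

theorem Gamma_add_nat {s : ℝ} (hs : 0 < s) (n : ℕ) :
    Real.Gamma (s + n) = poch s n * Real.Gamma s := by
  induction n with
  | zero => simp [poch_zero]
  | succ n ih =>
    have : s + (n + 1 : ℕ) = (s + n) + 1 := by push_cast; ring
    rw [this, Real.Gamma_add_one (by positivity), ih, poch_succ]
    ring

/-- The formal power series `(1 - r X)^(-b)`. -/
noncomputable def binom (b r : ℝ) : PowerSeries ℝ :=
  PowerSeries.mk fun n => poch b n * r ^ n / (n.factorial : ℝ)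

theorem coeff_binom (b r : ℝ) (n : ℕ) :
    coeff n (binom b r) = poch b n * r ^ n / (n.factorial : ℝ) := by
  simp [binom]

theorem coeff_succ_binom (b r : ℝ) (n : ℕ) :
    (n + 1) * coeff (n + 1) (binom b r) = (b + n) * r * coeff n (binom b r) := by
  rw [coeff_binom, coeff_binom, poch_succ, Nat.factorial_succ]
  have : (n.factorial : ℝ) ≠ 0 := by positivity
  push_cast
  field_simp
  ring

theorem GeomBound.binom (b r : ℝ) : GeomBound (binom b r) := by
  refine ⟨1, (|b| + 1) * |r|, by norm_num, by positivity, fun n => ?_⟩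
  rw [one_mul]
  induction n with
  | zero => simp [coeff_binom, poch_zero]
  | succ n ih =>
    have hn : (0 : ℝ) < n + 1 := by positivity
    have h : coeff (n + 1) (KappaMu.binom b r) =
        (b + n) / (n + 1) * r * coeff n (KappaMu.binom b r) := by
      have := coeff_succ_binom b r n
      field_simp
      linarith
    have hb : |(b + n) / (n + 1)| ≤ |b| + 1 := by
      rw [abs_div, abs_of_pos hn, div_le_iff₀ hn]
      calc |b + n| ≤ |b| + |(n : ℝ)| := abs_add_le _ _
        _ = |b| + n := by rw [Nat.abs_cast]
        _ ≤ (|b| + 1) * (n + 1) := by nlinarith [abs_nonneg b, (Nat.cast_nonneg n : (0 : ℝ) ≤ n)]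
    rw [h, abs_mul, abs_mul, pow_succ']
    gcongr

/-- The differential equation is the recursion `coeff_succ_binom`, which the constant term
determines. This yields the product law for real exponents. -/
theorem eq_binom_of_derivative {F : PowerSeries ℝ} {b r : ℝ} (h0 : coeff 0 F = 1)
    (h : (1 - PowerSeries.C r * X) * derivative ℝ F = PowerSeries.C (b * r) * F) :
    F = binom b r := by
  ext n
  induction n with
  | zero => simp [h0, coeff_binom, poch_zero]
  | succ n ih =>
    have hn : (0 : ℝ) < n + 1 := by positivity
    have h1 := congrArg (coeff n) h
    have h2 : (n + 1) * coeff (n + 1) F = (b + n) * r * coeff n F := by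
      rw [sub_mul, one_mul, map_sub, mul_assoc, PowerSeries.coeff_C_mul, PowerSeries.coeff_C_mul,
        coeff_derivative] at h1
      cases n with
      | zero => simp at h1 ⊢; linarith
      | succ k =>
        rw [coeff_succ_X_mul, coeff_derivative] at h1
        push_cast at h1 ⊢
        linarith
    rw [ih, ← coeff_succ_binom] at h2
    exact mul_left_cancel₀ hn.ne' h2

theorem derivative_binom (b r : ℝ) :
    (1 - PowerSeries.C r * X) * derivative ℝ (binom b r) = PowerSeries.C (b * r) * binom b r := by
  ext n
  rw [sub_mul, one_mul, map_sub, mul_assoc, PowerSeries.coeff_C_mul, PowerSeries.coeff_C_mul,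
    coeff_derivative]
  have h := coeff_succ_binom b r n
  cases n with
  | zero => simp at h ⊢; linarith
  | succ k =>
    rw [coeff_succ_X_mul, coeff_derivative]
    push_cast at h ⊢
    linarith

theorem binom_mul_binom (b c r : ℝ) : binom b r * binom c r = binom (b + c) r := by
  apply eq_binom_of_derivative
  · simp [PowerSeries.coeff_mul, coeff_binom, poch_zero]
  · rw [Derivation.leibniz, smul_eq_mul, smul_eq_mul]
    have h1 := derivative_binom b r
    have h2 := derivative_binom c r
    have h3 : (PowerSeries.C ((b + c) * r) : PowerSeries ℝ) =
      PowerSeries.C (b * r) + PowerSeries.C (c * r) := by rw [← map_add]; congr 1; ring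
    rw [h3]
    linear_combination binom b r * h2 + binom c r * h1

theorem rescale_binom (b r x : ℝ) : rescale x (binom b r) = binom b (r * x) := by
  ext n
  rw [coeff_rescale, coeff_binom, coeff_binom, mul_pow]
  ring

/-- Since `(m)_j (m+j)_l = (m)_(j+l)`, only the binomial theorem for `(q + r) ^ n` remains. -/
theorem binomial_compound_coeff (m q r : ℝ) (n : ℕ) :
    ∑ p ∈ antidiagonal n, coeff p.1 (binom m q) * coeff p.2 (binom (m + p.1) r) =
      coeff n (binom m (q + r)) := by
  rw [coeff_binom, (Commute.all q r).add_pow', Finset.mul_sum, Finset.sum_div]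
  refine Finset.sum_congr rfl fun p hp => ?_
  obtain rfl := mem_antidiagonal.1 hp
  rw [coeff_binom, coeff_binom, poch_add, nsmul_eq_mul, Nat.cast_add_choose]
  have h1 : (p.1.factorial : ℝ) ≠ 0 := by positivity
  have h2 : (p.2.factorial : ℝ) ≠ 0 := by positivity
  have h3 : ((p.1 + p.2).factorial : ℝ) ≠ 0 := by positivity
  field_simp

/-- The coefficients of `∑_j (m)_j / j! (q X)^j (1 - r X)^(-(b+j))`, in closed form. -/
theorem binomial_mixture_coeff (b m q r : ℝ) (n : ℕ) :
    ∑ p ∈ antidiagonal n, coeff p.1 (binom m q) * coeff p.2 (binom (b + p.1) r) =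
      coeff n (binom (b - m) r * binom m (q + r)) := by
  -- Splitting `b + j = (m + j) + (b - m)` isolates a factor free of `j`; the rest is
  -- `binomial_compound_coeff`.
  have h : ∀ j : ℕ, binom (b + j) r = binom (m + j) r * binom (b - m) r := fun j => by
    rw [binom_mul_binom]; congr 1; ring
  rw [mul_comm, PowerSeries.coeff_mul]
  simp_rw [h, PowerSeries.coeff_mul, ← binomial_compound_coeff, Finset.mul_sum, Finset.sum_mul]
  rw [Finset.sum_sigma', Finset.sum_sigma']
  -- Both sides run over triples `j + l + k = n`, grouped as `j + (l + k)` and as `(j + l) + k`.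
  refine Finset.sum_bij' (fun x _ => ⟨(x.1.1 + x.2.1, x.2.2), (x.1.1, x.2.1)⟩)
    (fun x _ => ⟨(x.2.1, x.2.2 + x.1.2), (x.2.2, x.1.2)⟩) ?_ ?_ ?_ ?_ ?_
  all_goals
    rintro ⟨⟨a, b⟩, ⟨c, d⟩⟩ h
    simp only [mem_sigma, HasAntidiagonal.mem_antidiagonal] at h ⊢
    obtain ⟨rfl, h⟩ := h
  · exact ⟨by omega, trivial⟩
  · exact ⟨by omega, trivial⟩
  · simp [h]
  · simp [h]
  · ring

/-! ### The Riemann–Liouville kernels -/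

/-- The kernel `x ^ (s - 1) / Γ(s)` on `(0, ∞)`, and `0` elsewhere. -/
noncomputable def rlKernel (s x : ℝ) : ℝ := if 0 < x then x ^ (s - 1) / Real.Gamma s else 0

theorem rlKernel_of_pos (s : ℝ) {x : ℝ} (hx : 0 < x) :
    rlKernel s x = x ^ (s - 1) / Real.Gamma s := if_pos hx

theorem rlKernel_of_nonpos (s : ℝ) {x : ℝ} (hx : x ≤ 0) : rlKernel s x = 0 := if_neg hx.not_gt

theorem rlKernel_nonneg {s : ℝ} (hs : 0 < s) (x : ℝ) : 0 ≤ rlKernel s x := by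
  unfold rlKernel
  split_ifs with h
  · exact div_nonneg (Real.rpow_nonneg h.le _) (Real.Gamma_pos_of_pos hs).le
  · exact le_rfl

theorem measurable_rlKernel (s : ℝ) : Measurable (rlKernel s) := by
  unfold rlKernel
  exact Measurable.ite measurableSet_Ioi (by fun_prop) measurable_const

theorem rlKernel_add_nat {s x : ℝ} (hs : 0 < s) (hx : 0 < x) (n : ℕ) :
    rlKernel (s + n) x = x ^ (s - 1) / Real.Gamma s * (x ^ n / poch s n) := by
  rw [rlKernel_of_pos _ hx, Gamma_add_nat hs, show s + n - 1 = (s - 1) + n by ring,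
    Real.rpow_add hx, Real.rpow_natCast]
  field_simp

theorem summable_pow_mul_rlKernel {s : ℝ} (hs : 0 < s) {R : ℝ} (hR : 0 ≤ R) (x : ℝ) :
    Summable fun n : ℕ => R ^ n * rlKernel (s + n) x := by
  rcases le_or_gt x 0 with hx | hx
  · simp [rlKernel_of_nonpos _ hx]
  -- Enlarging `R` keeps every term nonzero, as the ratio test requires, even when `R = 0`.
  suffices h : Summable fun n : ℕ => (R + 1) ^ n * rlKernel (s + n) x by
    refine h.of_nonneg_of_le (fun n => ?_) (fun n => ?_)
    · exact mul_nonneg (pow_nonneg hR _) (rlKernel_nonneg (by positivity) _)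
    · gcongr
      · exact rlKernel_nonneg (by positivity) _
      · linarith
  have hpos : ∀ n : ℕ, 0 < (R + 1) ^ n * rlKernel (s + n) x := fun n => by
    rw [rlKernel_add_nat hs hx]
    have := Real.Gamma_pos_of_pos hs
    have := poch_pos hs n
    positivity
  refine summable_of_ratio_test_tendsto_lt_one zero_lt_one
    (Filter.Eventually.of_forall fun n => (hpos n).ne') ?_
  have : (fun n : ℕ => ‖(R + 1) ^ (n + 1) * rlKernel (s + (n + 1 : ℕ)) x‖ /
      ‖(R + 1) ^ n * rlKernel (s + n) x‖) = fun n : ℕ => ((R + 1) * x) / (s + n) := by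
    funext n
    rw [Real.norm_of_nonneg (hpos _).le, Real.norm_of_nonneg (hpos _).le,
      rlKernel_add_nat hs hx, rlKernel_add_nat hs hx, poch_succ]
    have := Real.Gamma_pos_of_pos hs
    have := poch_pos hs n
    have : 0 < s + n := by positivity
    field_simp
    ring
  rw [this]
  exact tendsto_const_nhds.div_atTop
    (Filter.tendsto_atTop_add_const_left _ _ tendsto_natCast_atTop_atTop)

theorem summable_abs_coeff_mul_rlKernel {s : ℝ} (hs : 0 < s) {a : PowerSeries ℝ} (ha : GeomBound a)
    (x : ℝ) : Summable fun n : ℕ => |coeff n a| * rlKernel (s + n) x := by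
  obtain ⟨K, R, hK, hR, h⟩ := ha
  refine ((summable_pow_mul_rlKernel hs hR x).mul_left K).of_nonneg_of_le (fun n => ?_) (fun n => ?_)
  · exact mul_nonneg (abs_nonneg _) (rlKernel_nonneg (by positivity) _)
  · rw [← mul_assoc]
    exact mul_le_mul_of_nonneg_right (h n) (rlKernel_nonneg (by positivity) _)

theorem summable_norm_rlSeries {s : ℝ} (hs : 0 < s) {a : PowerSeries ℝ} (ha : GeomBound a)
    (x : ℝ) : Summable fun n : ℕ => ‖coeff n a * rlKernel (s + n) x‖ := by
  refine (summable_abs_coeff_mul_rlKernel hs ha x).congr fun n => ?_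
  rw [Real.norm_eq_abs, abs_mul,
    abs_of_nonneg (rlKernel_nonneg (by positivity : 0 < s + (n : ℝ)) x)]

theorem integral_Ioc_rpow_mul_rpow {s t x : ℝ} (hs : 0 < s) (ht : 0 < t) (hx : 0 < x) :
    ∫ y in Set.Ioc 0 x, y ^ (s - 1) * (x - y) ^ (t - 1) =
      x ^ (s + t - 1) * (Real.Gamma s * Real.Gamma t / Real.Gamma (s + t)) := by
  have h := Complex.betaIntegral_scaled (s : ℂ) (t : ℂ) hx
  rw [Complex.betaIntegral_eq_Gamma_mul_div _ _ (by simpa) (by simpa),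
    intervalIntegral.integral_of_le hx.le] at h
  have h2 : ∫ y in Set.Ioc 0 x, (y : ℂ) ^ ((s : ℂ) - 1) * ((x : ℂ) - y) ^ ((t : ℂ) - 1) =
      ((∫ y in Set.Ioc 0 x, y ^ (s - 1) * (x - y) ^ (t - 1) : ℝ) : ℂ) := by
    rw [← integral_complex_ofReal]
    refine setIntegral_congr_fun measurableSet_Ioc fun y hy => ?_
    have h3 : 0 ≤ x - y := sub_nonneg.2 hy.2
    simp only [Complex.ofReal_mul]
    rw [Complex.ofReal_cpow hy.1.le, Complex.ofReal_cpow h3]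
    push_cast
    rfl
  rw [h2] at h
  apply Complex.ofReal_injective
  rw [h, Complex.ofReal_mul, Complex.ofReal_cpow hx.le, Complex.ofReal_div, Complex.ofReal_mul,
    ← Complex.Gamma_ofReal, ← Complex.Gamma_ofReal, ← Complex.Gamma_ofReal]
  push_cast
  rfl

/-- Semigroup law of the kernels: the integrand lives on `0 < y < x`, where it is a beta integral.
-/
theorem integral_rlKernel_mul {s t : ℝ} (hs : 0 < s) (ht : 0 < t) (x : ℝ) :
    ∫ y, rlKernel s y * rlKernel t (x - y) = rlKernel (s + t) x := by
  have hG := Real.Gamma_pos_of_pos hs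
  have hG' := Real.Gamma_pos_of_pos ht
  rcases le_or_gt x 0 with hx | hx
  · rw [rlKernel_of_nonpos _ hx]
    refine integral_eq_zero_of_ae (Filter.Eventually.of_forall fun y => ?_)
    rcases le_or_gt y 0 with hy | hy
    · simp [rlKernel_of_nonpos _ hy]
    · simp [rlKernel_of_nonpos t (by linarith : x - y ≤ 0)]
  · have h : (fun y => rlKernel s y * rlKernel t (x - y)) = (Set.Ioo 0 x).indicator
        fun y => 1 / (Real.Gamma s * Real.Gamma t) * (y ^ (s - 1) * (x - y) ^ (t - 1)) := by
      funext y
      by_cases hy : y ∈ Set.Ioo 0 x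
      · rw [Set.indicator_of_mem hy, rlKernel_of_pos _ hy.1, rlKernel_of_pos _ (sub_pos.2 hy.2)]
        field_simp
      · rw [Set.indicator_of_notMem hy]
        rcases le_or_gt y 0 with h0 | h0
        · simp [rlKernel_of_nonpos _ h0]
        · have : x - y ≤ 0 := by
            by_contra h1
            exact hy ⟨h0, by linarith⟩
          simp [rlKernel_of_nonpos t this]
    rw [h, integral_indicator measurableSet_Ioo, integral_const_mul, ← integral_Ioc_eq_integral_Ioo,
      integral_Ioc_rpow_mul_rpow hs ht hx, rlKernel_of_pos _ hx]
    field_simp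

theorem integrable_rlKernel_mul {s t : ℝ} (hs : 0 < s) (ht : 0 < t) (x : ℝ) :
    Integrable fun y => rlKernel s y * rlKernel t (x - y) := by
  rcases le_or_gt x 0 with hx | hx
  · refine (integrable_zero ℝ ℝ volume).congr (Filter.Eventually.of_forall fun y => ?_)
    rcases le_or_gt y 0 with hy | hy
    · simp [rlKernel_of_nonpos _ hy]
    · simp [rlKernel_of_nonpos t (by linarith : x - y ≤ 0)]
  -- A non-integrable function would have integral 0, but the value just computed is positive.
  · by_contra h
    have h1 := integral_rlKernel_mul hs ht x
    rw [integral_undef h, rlKernel_of_pos _ hx] at h1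
    have := Real.Gamma_pos_of_pos (add_pos hs ht)
    have : 0 < x ^ (s + t - 1) / Real.Gamma (s + t) := by positivity
    linarith

/-! ### Series of kernels -/

/-- The function with Laplace transform `p ↦ p ^ (-s) a(1 / p)`. -/
noncomputable def rlSeries (s : ℝ) (a : PowerSeries ℝ) (x : ℝ) : ℝ :=
  ∑' n : ℕ, coeff n a * rlKernel (s + n) x

theorem measurable_rlSeries (s : ℝ) (a : PowerSeries ℝ) : Measurable (rlSeries s a) :=
  Measurable.tsum fun _ => (measurable_rlKernel _).const_mul _

theorem rlSeries_of_nonpos (s : ℝ) (a : PowerSeries ℝ) {x : ℝ} (hx : x ≤ 0) :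
    rlSeries s a x = 0 := by
  simp [rlSeries, rlKernel_of_nonpos _ hx]

theorem rlSeries_one (s x : ℝ) : rlSeries s 1 x = rlKernel s x := by
  rw [rlSeries, tsum_eq_single 0]
  · simp
  · intro n hn
    simp [PowerSeries.coeff_one, hn]

theorem integrable_tsum {F : ℕ × ℕ → ℝ → ℝ} (hm : ∀ i, Measurable (F i))
    (hF : ∀ i, Integrable (F i)) (hs : Summable fun i => ∫ y, ‖F i y‖) :
    Integrable fun y => ∑' i, F i y := by
  refine ⟨(Measurable.tsum hm).aestronglyMeasurable, ?_⟩
  have h1 : ∀ i, ∫⁻ y, ‖F i y‖ₑ = ENNReal.ofReal (∫ y, ‖F i y‖) := fun i => by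
    rw [ofReal_integral_norm_eq_lintegral_enorm (hF i)]
  calc ∫⁻ y, ‖∑' i, F i y‖ₑ ≤ ∫⁻ y, ∑' i, ‖F i y‖ₑ :=
        lintegral_mono fun y => enorm_tsum_le_tsum_enorm
    _ = ∑' i, ∫⁻ y, ‖F i y‖ₑ := lintegral_tsum fun i => (hm i).enorm.aemeasurable
    _ = ENNReal.ofReal (∑' i, ∫ y, ‖F i y‖) := by
        simp_rw [h1]
        rw [ENNReal.ofReal_tsum_of_nonneg _ hs]
        exact fun i => integral_nonneg fun y => norm_nonneg _
    _ < ⊤ := ENNReal.ofReal_lt_top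

/-- Termwise integration of the double series uses the semigroup law; grouping by total degree then
produces the Cauchy product. Absolute convergence comes from the same computation with `absSeries`.
-/
theorem rlSeries_conv {s t : ℝ} (hs : 0 < s) (ht : 0 < t) {a b : PowerSeries ℝ}
    (ha : GeomBound a) (hb : GeomBound b) (x : ℝ) :
    (Integrable fun y => rlSeries s a y * rlSeries t b (x - y)) ∧
      ∫ y, rlSeries s a y * rlSeries t b (x - y) = rlSeries (s + t) (a * b) x := by
  let F : ℕ × ℕ → ℝ → ℝ := fun p y =>
    coeff p.1 a * coeff p.2 b * (rlKernel (s + p.1) y * rlKernel (t + p.2) (x - y))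
  have hs' : ∀ n : ℕ, 0 < s + n := fun n => by positivity
  have ht' : ∀ n : ℕ, 0 < t + n := fun n => by positivity
  have hF : ∀ p, Integrable (F p) := fun p =>
    (integrable_rlKernel_mul (hs' p.1) (ht' p.2) x).const_mul _
  have hm : ∀ p, Measurable (F p) := fun p =>
    ((measurable_rlKernel _).mul
      ((measurable_rlKernel _).comp (measurable_const.sub measurable_id))).const_mul _
  have hk : ∀ p : ℕ × ℕ, ∀ N, p ∈ HasAntidiagonal.antidiagonal N →
      rlKernel ((s + p.1) + (t + p.2)) x = rlKernel (s + t + N) x := by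
    rintro ⟨i, j⟩ N h
    rw [← HasAntidiagonal.mem_antidiagonal.1 h]
    congr 1
    push_cast
    ring
  have hint : ∀ p, ∫ y, F p y =
      coeff p.1 a * coeff p.2 b * rlKernel ((s + p.1) + (t + p.2)) x := fun p => by
    rw [← integral_rlKernel_mul (hs' p.1) (ht' p.2) x, ← integral_const_mul]
  -- Each `F p` has constant sign, the kernels being nonnegative.
  have hnorm : ∀ p, ∫ y, ‖F p y‖ = |∫ y, F p y| := fun p => by
    rw [hint, abs_mul, abs_of_nonneg (rlKernel_nonneg (add_pos (hs' p.1) (ht' p.2)) x),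
      ← integral_rlKernel_mul (hs' p.1) (ht' p.2) x, ← integral_const_mul]
    refine integral_congr_ae (Filter.Eventually.of_forall fun y => ?_)
    simp only [F]
    rw [Real.norm_eq_abs, abs_mul,
      abs_of_nonneg (mul_nonneg (rlKernel_nonneg (hs' p.1) y) (rlKernel_nonneg (ht' p.2) _))]
  have hgroup : Summable fun N => ∑ p ∈ HasAntidiagonal.antidiagonal N, |∫ y, F p y| := by
    refine (summable_abs_coeff_mul_rlKernel (add_pos hs ht)
      (ha.absSeries.mul hb.absSeries) x).congr fun N => ?_
    rw [PowerSeries.coeff_mul, abs_of_nonneg, Finset.sum_mul]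
    · refine Finset.sum_congr rfl fun p hp => ?_
      rw [hint, hk p N hp, abs_mul, abs_mul, coeff_absSeries, coeff_absSeries,
        abs_of_nonneg (rlKernel_nonneg (by positivity : 0 < s + t + (N : ℝ)) x)]
    · refine Finset.sum_nonneg fun p _ => ?_
      rw [coeff_absSeries, coeff_absSeries]
      positivity
  obtain ⟨hsum, htot⟩ := hasSum_of_grading (fun p : ℕ × ℕ => p.1 + p.2)
    HasAntidiagonal.antidiagonal
    (fun p N => HasAntidiagonal.mem_antidiagonal) (fun p => ∫ y, F p y) hgroup
  have hsumn : Summable fun p => ∫ y, ‖F p y‖ := by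
    simp_rw [hnorm]
    exact hsum.abs
  have hprod : ∀ y, rlSeries s a y * rlSeries t b (x - y) = ∑' p, F p y := fun y => by
    rw [rlSeries, rlSeries, tsum_mul_tsum_of_summable_norm (summable_norm_rlSeries hs ha y)
      (summable_norm_rlSeries ht hb (x - y))]
    exact tsum_congr fun p => mul_mul_mul_comm _ _ _ _
  simp_rw [hprod]
  refine ⟨integrable_tsum hm hF hsumn, ?_⟩
  rw [← (hasSum_integral_of_summable_integral_norm hF hsumn).tsum_eq, htot.tsum_eq, rlSeries]
  refine tsum_congr fun N => ?_
  rw [PowerSeries.coeff_mul, Finset.sum_mul]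
  refine Finset.sum_congr rfl fun p hp => ?_
  rw [hint, hk p N hp]

theorem rlSeries_conv_nonneg {s t : ℝ} (hs : 0 < s) (ht : 0 < t) {a b : PowerSeries ℝ}
    (ha : GeomBound a) (hb : GeomBound b) (ha0 : ∀ x, 0 ≤ rlSeries s a x)
    (hb0 : ∀ x, 0 ≤ rlSeries t b x) (x : ℝ) : 0 ≤ rlSeries (s + t) (a * b) x := by
  rw [← (rlSeries_conv hs ht ha hb x).2]
  exact integral_nonneg fun y => mul_nonneg (ha0 _) (hb0 _)

theorem lintegral_rlSeries_conv {s t : ℝ} (hs : 0 < s) (ht : 0 < t) {a b : PowerSeries ℝ}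
    (ha : GeomBound a) (hb : GeomBound b) (ha0 : ∀ x, 0 ≤ rlSeries s a x)
    (hb0 : ∀ x, 0 ≤ rlSeries t b x) (x : ℝ) :
    ∫⁻ y, ENNReal.ofReal (rlSeries s a y) * ENNReal.ofReal (rlSeries t b (x - y)) =
      ENNReal.ofReal (rlSeries (s + t) (a * b) x) := by
  obtain ⟨h1, h2⟩ := rlSeries_conv hs ht ha hb x
  rw [← h2, ofReal_integral_eq_lintegral_ofReal h1
    (Filter.Eventually.of_forall fun y => mul_nonneg (ha0 _) (hb0 _))]
  exact lintegral_congr fun y => (ENNReal.ofReal_mul (ha0 y)).symm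

/-- The measure with density `rlSeries s a`. -/
noncomputable def rlMeasure (s : ℝ) (a : PowerSeries ℝ) : Measure ℝ :=
  volume.withDensity fun x => ENNReal.ofReal (rlSeries s a x)

theorem rlMeasure_conv {s t : ℝ} (hs : 0 < s) (ht : 0 < t) {a b : PowerSeries ℝ}
    (ha : GeomBound a) (hb : GeomBound b) (ha0 : ∀ x, 0 ≤ rlSeries s a x)
    (hb0 : ∀ x, 0 ≤ rlSeries t b x) :
    (rlMeasure s a).conv (rlMeasure t b) = rlMeasure (s + t) (a * b) := by
  unfold rlMeasure
  rw [conv_withDensity_eq_lconvolution (measurable_rlSeries s a).ennreal_ofReal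
    (measurable_rlSeries t b).ennreal_ofReal]
  congr 1
  funext x
  rw [lconvolution_def, ← lintegral_rlSeries_conv hs ht ha hb ha0 hb0 x]
  exact lintegral_congr fun y => by rw [neg_add_eq_sub]

/-- `rlSeries 1 1` is the indicator of `(0, ∞)`, so convolving with it integrates the density over
`y < x`; the endpoint is a null set. -/
theorem rlMeasure_Iic {s : ℝ} (hs : 0 < s) {a : PowerSeries ℝ} (ha : GeomBound a)
    (ha0 : ∀ x, 0 ≤ rlSeries s a x) (x : ℝ) :
    rlMeasure s a (Set.Iic x) = ENNReal.ofReal (rlSeries (s + 1) a x) := by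
  have h1 : ∀ y, rlSeries 1 1 y = if 0 < y then 1 else 0 := fun y => by
    rw [rlSeries_one, rlKernel]
    simp
  have h := lintegral_rlSeries_conv hs zero_lt_one ha GeomBound.one ha0
    (fun y => by rw [h1]; split_ifs <;> norm_num) x
  rw [mul_one] at h
  rw [← h, rlMeasure, withDensity_apply _ measurableSet_Iic, ← setLIntegral_congr Iio_ae_eq_Iic,
    ← lintegral_indicator measurableSet_Iio]
  refine lintegral_congr fun y => ?_
  rw [h1]
  by_cases hy : y < x
  · rw [Set.indicator_of_mem (Set.mem_Iio.2 hy), if_pos (by linarith)]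
    simp
  · rw [Set.indicator_of_notMem (by simpa using hy), if_neg (by linarith)]
    simp

theorem rlSeries_succ_nonneg {s : ℝ} (hs : 0 < s) {a : PowerSeries ℝ} (ha : GeomBound a)
    (ha0 : ∀ x, 0 ≤ rlSeries s a x) (x : ℝ) : 0 ≤ rlSeries (s + 1) a x := by
  have := rlSeries_conv_nonneg hs zero_lt_one ha GeomBound.one ha0
    (fun y => by rw [rlSeries_one]; exact rlKernel_nonneg zero_lt_one y) x
  rwa [mul_one] at this

/-! ### The confluent hypergeometric function `Φ₂` as a series of kernels -/

theorem coeff_prod_univ {ι : Type*} [Fintype ι] [DecidableEq ι] (f : ι → PowerSeries ℝ) (N : ℕ) :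
    coeff N (∏ i, f i) = ∑ n ∈ Finset.piAntidiag univ N, ∏ i, coeff (n i) (f i) := by
  rw [PowerSeries.coeff_prod]
  refine Finset.sum_bij' (fun l _ => ⇑l) (fun n _ => Finsupp.equivFunOnFinite.symm n) ?_ ?_ ?_ ?_ ?_
  · intro l hl
    simpa using (mem_finsuppAntidiag.1 hl).1
  · intro n hn
    simpa using (mem_piAntidiag.1 hn).1
  · intro l _
    ext i
    simp
  · intro n _
    simp
  · intro l _
    rfl

/-- At `x = 1` the kernel of order `c + N` is `1 / (Γ(c) (c)_N)`, so `Φ₂` becomes a kernel series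
whose arguments are the rates of the binomial factors. -/
theorem phi2Term_eq {ι : Type*} [Fintype ι] (b : ι → ℝ) {c : ℝ} (hc : 0 < c) (z : ι → ℝ)
    (n : ι → ℕ) : phi2Term b c z n =
      Real.Gamma c * ((∏ i, coeff (n i) (binom (b i) (z i))) * rlKernel (c + (∑ i, n i : ℕ)) 1) := by
  have := Real.Gamma_pos_of_pos hc
  have := poch_pos hc (∑ i, n i)
  simp_rw [phi2Term, coeff_binom]
  rw [rlKernel_add_nat hc one_pos, Real.one_rpow, one_pow]
  field_simp

theorem hasSum_phi2Term {ι : Type*} [Fintype ι] (b : ι → ℝ) {c : ℝ} (hc : 0 < c) (z : ι → ℝ) :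
    HasSum (phi2Term b c z) (Real.Gamma c * rlSeries c (∏ i, binom (b i) (z i)) 1) := by
  classical
  have h : HasSum (fun n : ι → ℕ =>
      (∏ i, coeff (n i) (binom (b i) (z i))) * rlKernel (c + (∑ i, n i : ℕ)) 1)
      (rlSeries c (∏ i, binom (b i) (z i)) 1) := by
    have hA : ∀ (n : ι → ℕ) (N : ℕ), n ∈ Finset.piAntidiag univ N ↔ ∑ i, n i = N := by simp
    convert (hasSum_of_grading (fun n : ι → ℕ => ∑ i, n i) (fun N => Finset.piAntidiag univ N) hA
      (fun n => (∏ i, coeff (n i) (binom (b i) (z i))) * rlKernel (c + (∑ i, n i : ℕ)) 1) ?_).2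
      using 1
    · rw [rlSeries]
      refine tsum_congr fun N => ?_
      rw [coeff_prod_univ, Finset.sum_mul]
      exact Finset.sum_congr rfl fun n hn => by rw [(hA n N).1 hn]
    · refine (summable_abs_coeff_mul_rlKernel hc (GeomBound.prod univ fun i _ =>
        (GeomBound.binom (b i) (z i)).absSeries) 1).congr fun N => ?_
      rw [coeff_prod_univ, abs_of_nonneg, Finset.sum_mul]
      · refine Finset.sum_congr rfl fun n hn => ?_
        rw [(hA n N).1 hn, abs_mul, Finset.abs_prod,
          abs_of_nonneg (rlKernel_nonneg (by positivity : 0 < c + (N : ℝ)) 1)]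
        simp_rw [coeff_absSeries]
      · refine Finset.sum_nonneg fun n _ => Finset.prod_nonneg fun i _ => ?_
        rw [coeff_absSeries]
        exact abs_nonneg _
  have h2 : phi2Term b c z = fun n => Real.Gamma c *
      ((∏ i, coeff (n i) (binom (b i) (z i))) * rlKernel (c + (∑ i, n i : ℕ)) 1) :=
    funext fun n => phi2Term_eq b hc z n
  rw [h2]
  exact h.mul_left _

theorem rlSeries_prod_binom {ι : Type*} [Fintype ι] (b r : ι → ℝ) {c : ℝ} (hc : 0 < c) {x : ℝ}
    (hx : 0 < x) : rlSeries c (∏ i, binom (b i) (r i)) x =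
      1 / Real.Gamma c * x ^ (c - 1) * phi2 b c (fun i => r i * x) := by
  have hG := Real.Gamma_pos_of_pos hc
  rw [phi2, (hasSum_phi2Term b hc _).tsum_eq]
  -- Homogeneity: multiplying every rate by `x` multiplies the degree `N` coefficient by `x ^ N`,
  -- which passes to the kernel.
  simp_rw [← rescale_binom]
  rw [← map_prod, rlSeries, rlSeries, ← tsum_mul_left, ← tsum_mul_left]
  refine tsum_congr fun N => ?_
  rw [coeff_rescale, rlKernel_add_nat hc hx, rlKernel_add_nat hc one_pos, Real.one_rpow, one_pow]
  field_simp

theorem rlSeries_C_mul (s r : ℝ) (a : PowerSeries ℝ) (x : ℝ) :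
    rlSeries s (PowerSeries.C r * a) x = r * rlSeries s a x := by
  rw [rlSeries, rlSeries, ← tsum_mul_left]
  exact tsum_congr fun n => by rw [PowerSeries.coeff_C_mul, mul_assoc]

/-! ### Negative binomial mixtures of Gamma densities -/

/-- The factor `(s)_l` cancels between coefficient and kernel, leaving the exponential series. -/
theorem hasSum_binom_exp {s x : ℝ} (hs : 0 < s) (r : ℝ) :
    HasSum (fun l : ℕ => coeff l (binom s r) * rlKernel (s + l) x)
      (Real.exp (r * x) * rlKernel s x) := by
  rcases le_or_gt x 0 with hx | hx
  · simp [rlKernel_of_nonpos _ hx, hasSum_zero]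
  have h := (NormedSpace.expSeries_div_hasSum_exp (r * x)).mul_right (rlKernel s x)
  rw [← Real.exp_eq_exp_ℝ] at h
  refine h.congr_fun fun l => ?_
  have := poch_pos hs l
  rw [coeff_binom, rlKernel_add_nat hs hx, rlKernel_of_pos _ hx, mul_pow]
  field_simp

theorem tsum_prod_eq_tsum_antidiagonal {f : ℕ × ℕ → ℝ} (hf : Summable f) :
    ∑' p, f p = ∑' N, ∑ p ∈ HasAntidiagonal.antidiagonal N, f p := by
  let e := HasAntidiagonal.sigmaAntidiagonalEquivProd (A := ℕ)
  have h : Summable fun p => f (e p) := e.summable_iff.2 hf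
  rw [← e.tsum_eq f, h.tsum_sigma]
  refine tsum_congr fun N => ?_
  rw [tsum_fintype]
  exact Finset.sum_coe_sort (HasAntidiagonal.antidiagonal N) f

theorem coeff_binom_nonneg {b r : ℝ} (hb : 0 < b) (hr : 0 ≤ r) (n : ℕ) :
    0 ≤ coeff n (binom b r) := by
  have := poch_pos hb n
  rw [coeff_binom]
  positivity

theorem abs_coeff_binom {b : ℝ} (hb : 0 < b) (r : ℝ) (n : ℕ) :
    |coeff n (binom b r)| = coeff n (binom b |r|) := by
  rw [coeff_binom, coeff_binom, abs_div, abs_mul, abs_pow, abs_of_pos (poch_pos hb n), Nat.abs_cast]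

/-- Each exponential is expanded by `hasSum_binom_exp`, and the double series is regrouped by
degree, where `binomial_mixture_coeff` applies. The absolute values form the same double series with
`|r|` for `r`. -/
theorem hasSum_binomial_mixture {b m q : ℝ} (hb : 0 < b) (hm : 0 < m) (hq : 0 ≤ q) (r x : ℝ) :
    HasSum (fun j : ℕ => coeff j (binom m q) * (Real.exp (r * x) * rlKernel (b + j) x))
      (rlSeries b (binom (b - m) r * binom m (q + r)) x) := by
  have hbj : ∀ j : ℕ, 0 < b + j := fun j => by positivity
  have hout : ∀ t : ℝ, Summable fun j : ℕ =>
      coeff j (binom m q) * (Real.exp (t * x) * rlKernel (b + j) x) := fun t => by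
    refine ((summable_abs_coeff_mul_rlKernel hb (GeomBound.binom m q) x).mul_left
      (Real.exp (t * x))).congr fun j => ?_
    rw [abs_of_nonneg (coeff_binom_nonneg hm hq j)]
    ring
  let g : ℕ × ℕ → ℝ := fun p =>
    coeff p.1 (binom m q) * (coeff p.2 (binom (b + p.1) r) * rlKernel (b + p.1 + p.2) x)
  have hin : ∀ j : ℕ, HasSum (fun l => g (j, l))
      (coeff j (binom m q) * (Real.exp (r * x) * rlKernel (b + j) x)) := fun j =>
    (hasSum_binom_exp (hbj j) r).mul_left _
  have hin' : ∀ j : ℕ, HasSum (fun l => |g (j, l)|)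
      (coeff j (binom m q) * (Real.exp (|r| * x) * rlKernel (b + j) x)) := fun j => by
    refine ((hasSum_binom_exp (x := x) (hbj j) |r|).mul_left (coeff j (binom m q))).congr_fun
      fun l => ?_
    have hl : 0 < b + j + l := by positivity
    simp only [g]
    rw [abs_mul, abs_mul, abs_of_nonneg (coeff_binom_nonneg hm hq j), abs_coeff_binom (hbj j),
      abs_of_nonneg (rlKernel_nonneg hl x)]
  have hg : Summable g := by
    refine Summable.of_abs ((summable_prod_of_nonneg fun p => abs_nonneg (g p)).2
      ⟨fun j => (hin' j).summable, ?_⟩)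
    exact (hout |r|).congr fun j => ((hin' j).tsum_eq).symm
  convert (hout r).hasSum using 1
  rw [← tsum_congr fun j => (hin j).tsum_eq, ← hg.tsum_prod, tsum_prod_eq_tsum_antidiagonal hg,
    rlSeries]
  refine tsum_congr fun N => ?_
  rw [← binomial_mixture_coeff, Finset.sum_mul]
  refine Finset.sum_congr rfl fun p hp => ?_
  rw [← HasAntidiagonal.mem_antidiagonal.1 hp]
  simp only [g]
  push_cast
  rw [add_assoc, mul_assoc]

/-! ### The `κ`-`μ` shadowed density -/

/-- Expanding the Bessel function gives Poisson weights of mean `ξ² μ κ` on Gamma densities of shape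
`μ + j` and rate `μ (1 + κ) / gbar`. -/
theorem kappaMuCondPDF_eq_tsum {gbar κ μ ξ x : ℝ} (hg : 0 < gbar) (hκ : 0 ≤ κ) (hμ : 0 < μ)
    (hξ : 0 < ξ) (hx : 0 < x) :
    kappaMuCondPDF gbar κ μ ξ x = ∑' j : ℕ, (ξ ^ 2 * (μ * κ)) ^ j / (j.factorial : ℝ) *
      Real.exp (-(ξ ^ 2 * (μ * κ))) * ((μ * (1 + κ) / gbar) ^ (μ + j) *
        (Real.exp (-(μ * (1 + κ) / gbar) * x) * rlKernel (μ + j) x)) := by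
  have hG := Real.Gamma_pos_of_pos hμ
  rw [kappaMuCondPDF, if_pos hx]
  split_ifs with h0
  · subst h0
    -- The Poisson mean is 0, so only `j = 0` survives.
    rw [tsum_eq_single 0]
    · rw [gammaPDFReal, if_pos hx.le]
      simp only [mul_zero, pow_zero, Nat.factorial_zero, Nat.cast_one, Nat.cast_zero, neg_zero,
        Real.exp_zero, add_zero, mul_one, div_one, one_mul, neg_mul]
      rw [rlKernel_of_pos _ hx]
      field_simp
    · intro j hj
      simp [hj]
  · have hκ' : 0 < κ := lt_of_le_of_ne hκ (Ne.symm h0)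
    rw [besselI, ← tsum_mul_left]
    refine tsum_congr fun j => ?_
    have hGj : 0 < Real.Gamma (μ + j) := Real.Gamma_pos_of_pos (by positivity)
    have hz : 2 * μ * ξ * Real.sqrt (κ * (1 + κ) * x / gbar) / 2 =
        Real.sqrt (ξ ^ 2 * (μ * κ) * (μ * (1 + κ) / gbar * x)) := by
      rw [show ξ ^ 2 * (μ * κ) * (μ * (1 + κ) / gbar * x) =
        (μ * ξ) ^ 2 * (κ * (1 + κ) * x / gbar) by ring, Real.sqrt_mul (by positivity),
        Real.sqrt_sq (by positivity)]
      ring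
    have hbase : 0 < ξ ^ 2 * (μ * κ) * (μ * (1 + κ) / gbar * x) := by positivity
    have hpow : Real.sqrt (ξ ^ 2 * (μ * κ) * (μ * (1 + κ) / gbar * x)) ^ (2 * (j : ℝ) + (μ - 1)) =
        (ξ ^ 2 * (μ * κ) * (μ * (1 + κ) / gbar * x)) ^ ((μ - 1) / 2) *
          (ξ ^ 2 * (μ * κ) * (μ * (1 + κ) / gbar * x)) ^ j := by
      rw [Real.sqrt_eq_rpow, ← Real.rpow_mul hbase.le, ← Real.rpow_natCast _ j,
        ← Real.rpow_add hbase]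
      congr 1
      ring
    -- In the part independent of `j`, all powers of `ξ` and all powers of `κ` alone cancel.
    have hcoef : μ * (1 + κ) ^ ((μ + 1) / 2) / (gbar * κ ^ ((μ - 1) / 2)) *
        (x / (ξ ^ 2 * gbar)) ^ ((μ - 1) / 2) *
        (ξ ^ 2 * (μ * κ) * (μ * (1 + κ) / gbar * x)) ^ ((μ - 1) / 2) =
        (μ * (1 + κ) / gbar) ^ μ * x ^ (μ - 1) := by
      have h1 : (1 + κ) ^ ((μ + 1) / 2) = (1 + κ) * (1 + κ) ^ ((μ - 1) / 2) := by
        rw [← Real.rpow_one_add' (by positivity) (by linarith)]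
        congr 1
        ring
      have h2 : (μ * (1 + κ) / gbar) ^ μ * x ^ (μ - 1) =
          μ * (1 + κ) / gbar * (μ * (1 + κ) / gbar * x) ^ (μ - 1) := by
        rw [Real.mul_rpow (by positivity) hx.le, ← mul_assoc]
        congr 1
        rw [← Real.rpow_one_add' (by positivity) (by linarith)]
        congr 1
        ring
      have h3 : (μ * (1 + κ) / gbar * x) ^ (μ - 1) =
          ((1 + κ) / κ * (x / (ξ ^ 2 * gbar)) *
            (ξ ^ 2 * (μ * κ) * (μ * (1 + κ) / gbar * x))) ^ ((μ - 1) / 2) := by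
        have : (1 + κ) / κ * (x / (ξ ^ 2 * gbar)) *
            (ξ ^ 2 * (μ * κ) * (μ * (1 + κ) / gbar * x)) = (μ * (1 + κ) / gbar * x) ^ (2 : ℝ) := by
          rw [Real.rpow_two]
          field_simp
        rw [this, ← Real.rpow_mul (by positivity)]
        congr 1
        ring
      rw [h2, h3, Real.mul_rpow (x := (1 + κ) / κ * (x / (ξ ^ 2 * gbar))) (by positivity) hbase.le,
        Real.mul_rpow (x := (1 + κ) / κ) (by positivity) (by positivity),
        Real.div_rpow (by positivity) hκ, h1]
      field_simp
    rw [hz, hpow, rlKernel_of_pos _ hx, show (j : ℝ) + (μ - 1) + 1 = μ + j by ring,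
      Real.rpow_add (by positivity : 0 < μ * (1 + κ) / gbar), Real.rpow_natCast,
      show μ + j - 1 = (μ - 1) + (j : ℝ) by ring, Real.rpow_add hx, Real.rpow_natCast,
      show -(μ * (1 + κ) * x / gbar) = -(μ * (1 + κ) / gbar) * x by ring,
      show ξ ^ 2 * μ * κ = ξ ^ 2 * (μ * κ) by ring, Real.exp_neg (ξ ^ 2 * (μ * κ))]
    calc _ = (μ * (1 + κ) ^ ((μ + 1) / 2) / (gbar * κ ^ ((μ - 1) / 2)) *
        (x / (ξ ^ 2 * gbar)) ^ ((μ - 1) / 2) *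
        (ξ ^ 2 * (μ * κ) * (μ * (1 + κ) / gbar * x)) ^ ((μ - 1) / 2)) *
        ((Real.exp (ξ ^ 2 * (μ * κ)))⁻¹ * Real.exp (-(μ * (1 + κ) / gbar) * x) *
          (ξ ^ 2 * (μ * κ) * (μ * (1 + κ) / gbar * x)) ^ j /
            ((j.factorial : ℝ) * Real.Gamma (μ + j))) := by
          field_simp
      _ = _ := by
          rw [hcoef, mul_pow (ξ ^ 2 * (μ * κ)), mul_pow (μ * (1 + κ) / gbar)]
          field_simp

/-! ### Averaging over the Nakagami amplitude -/

theorem measurable_nakagamiPDF (m : ℝ) : Measurable (nakagamiPDF m) := by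
  unfold nakagamiPDF
  exact Measurable.ite measurableSet_Ioi (by fun_prop) measurable_const

/-- A Poisson variable whose mean is mixed by a Nakagami law is negative binomial. -/
theorem lintegral_poisson_nakagami {m A : ℝ} (hm : 0 < m) (hA : 0 ≤ A) (j : ℕ) :
    ∫⁻ ξ in Set.Ioi (0 : ℝ), ENNReal.ofReal ((ξ ^ 2 * A) ^ j / (j.factorial : ℝ) *
      Real.exp (-(ξ ^ 2 * A))) * ENNReal.ofReal (nakagamiPDF m ξ) =
      ENNReal.ofReal ((m / (A + m)) ^ m * coeff j (binom m (A / (A + m)))) := by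
  have hG := Real.Gamma_pos_of_pos hm
  have hAm : 0 < A + m := by positivity
  have hGj : 0 < Real.Gamma (m + j) := Real.Gamma_pos_of_pos (by positivity)
  -- The exponent adds `2m - 1` from the Nakagami density to `2j` from the Poisson weight.
  have hI := integral_rpow_mul_exp_neg_mul_rpow (p := 2) (q := 2 * (m + j) - 1) (b := A + m)
    two_pos (by have : (0 : ℝ) ≤ j := Nat.cast_nonneg j; linarith) hAm
  rw [show -(2 * (m + j) - 1 + 1) / 2 = -(m + j) by ring,
    show (2 * (m + j) - 1 + 1) / 2 = m + j by ring] at hI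
  have hint : IntegrableOn (fun ξ : ℝ => ξ ^ (2 * (m + j) - 1) * Real.exp (-(A + m) * ξ ^ (2 : ℝ)))
      (Set.Ioi 0) := by
    by_contra h
    rw [integral_undef h] at hI
    have : 0 < (A + m) ^ (-(m + j)) * (1 / 2) * Real.Gamma (m + j) := by positivity
    linarith
  have heq : ∀ ξ ∈ Set.Ioi (0 : ℝ), ENNReal.ofReal ((ξ ^ 2 * A) ^ j / (j.factorial : ℝ) *
      Real.exp (-(ξ ^ 2 * A))) * ENNReal.ofReal (nakagamiPDF m ξ) =
      ENNReal.ofReal (A ^ j / (j.factorial : ℝ) * (2 * m ^ m / Real.Gamma m) *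
        (ξ ^ (2 * (m + j) - 1) * Real.exp (-(A + m) * ξ ^ (2 : ℝ)))) := by
    intro ξ hξ
    have hξ : 0 < ξ := hξ
    rw [← ENNReal.ofReal_mul (by positivity), nakagamiPDF, if_pos hξ,
      show 2 * (m + j) - 1 = (2 * m - 1) + ((2 * j : ℕ) : ℝ) by push_cast; ring,
      Real.rpow_add hξ, Real.rpow_natCast, Real.rpow_two,
      show -(A + m) * ξ ^ 2 = -(ξ ^ 2 * A) + -(m * ξ ^ 2) by ring, Real.exp_add, mul_pow, pow_mul]
    congr 1
    ring
  rw [setLIntegral_congr_fun measurableSet_Ioi heq, ← ofReal_integral_eq_lintegral_ofReal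
    (hint.const_mul _), integral_const_mul, hI]
  · congr 1
    rw [coeff_binom, add_comm m, add_comm (j : ℝ), Gamma_add_nat hm, Real.rpow_neg hAm.le,
      Real.rpow_add hAm, Real.rpow_natCast, Real.div_rpow hm.le hAm.le, div_pow]
    field_simp
  · filter_upwards [ae_restrict_mem measurableSet_Ioi] with ξ hξ
    have hξ : 0 < ξ := hξ
    simp only [Pi.zero_apply]
    positivity

/-- The power series whose kernel series is the `κ`-`μ` shadowed density. -/
noncomputable def shadowedSeries (gbar κ μ m : ℝ) : PowerSeries ℝ :=
  PowerSeries.C (μ ^ μ * m ^ m * (1 + κ) ^ μ / (μ * κ + m) ^ m * (1 / gbar) ^ μ) *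
    (binom (μ - m) (-(μ * (1 + κ)) / gbar) *
      binom m (-(μ * (1 + κ)) / gbar * (m / (μ * κ + m))))

theorem GeomBound.shadowedSeries (gbar κ μ m : ℝ) : GeomBound (shadowedSeries gbar κ μ m) :=
  (GeomBound.C _).mul ((GeomBound.binom _ _).mul (GeomBound.binom _ _))

theorem hasSum_shadowedSeries {gbar κ μ m : ℝ} (hg : 0 < gbar) (hκ : 0 ≤ κ) (hμ : 0 < μ)
    (hm : 0 < m) (x : ℝ) :
    HasSum (fun j : ℕ => (m / (μ * κ + m)) ^ m * coeff j (binom m (μ * κ / (μ * κ + m))) *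
      ((μ * (1 + κ) / gbar) ^ (μ + j) *
        (Real.exp (-(μ * (1 + κ) / gbar) * x) * rlKernel (μ + j) x)))
      (rlSeries μ (shadowedSeries gbar κ μ m) x) := by
  have hA : 0 < μ * κ + m := by positivity
  have hβ : 0 < μ * (1 + κ) / gbar := by positivity
  have h := (hasSum_binomial_mixture (q := μ * (1 + κ) / gbar * (μ * κ / (μ * κ + m))) hμ hm
    (by positivity) (-(μ * (1 + κ) / gbar)) x).mul_left
    ((m / (μ * κ + m)) ^ m * (μ * (1 + κ) / gbar) ^ μ)
  rw [shadowedSeries, rlSeries_C_mul]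
  have hconst : μ ^ μ * m ^ m * (1 + κ) ^ μ / (μ * κ + m) ^ m * (1 / gbar) ^ μ =
      (m / (μ * κ + m)) ^ m * (μ * (1 + κ) / gbar) ^ μ := by
    rw [Real.div_rpow hm.le hA.le, Real.div_rpow (x := μ * (1 + κ)) (by positivity) hg.le,
      Real.mul_rpow hμ.le (by positivity), Real.div_rpow zero_le_one hg.le, Real.one_rpow]
    ring
  -- The merged rate `q + r` of the closed form, by `1 - μκ/(μκ+m) = m/(μκ+m)`.
  have hrate : -(μ * (1 + κ) / gbar) * (m / (μ * κ + m)) =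
      μ * (1 + κ) / gbar * (μ * κ / (μ * κ + m)) + -(μ * (1 + κ) / gbar) := by
    field_simp
    ring
  rw [hconst, neg_div, hrate]
  refine h.congr_fun fun j => ?_
  rw [coeff_binom, coeff_binom, Real.rpow_add hβ, Real.rpow_natCast, mul_pow]
  ring

/-- The coefficients of `shadowedSeries` can be negative; positivity is visible only in the mixture
form. -/
theorem rlSeries_shadowedSeries_nonneg {gbar κ μ m : ℝ} (hg : 0 < gbar) (hκ : 0 ≤ κ) (hμ : 0 < μ)
    (hm : 0 < m) (x : ℝ) : 0 ≤ rlSeries μ (shadowedSeries gbar κ μ m) x := by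
  refine (hasSum_shadowedSeries hg hκ hμ hm x).nonneg fun j => ?_
  have h1 := coeff_binom_nonneg hm (by positivity : 0 ≤ μ * κ / (μ * κ + m)) j
  have h2 := rlKernel_nonneg (by positivity : 0 < μ + (j : ℝ)) x
  positivity

/-- All terms are nonnegative, so sum and integral over `ξ` exchange, and each integral is a
negative binomial weight. -/
theorem kappaMuShadowed_eq {gbar κ μ m : ℝ} (hg : 0 < gbar) (hκ : 0 ≤ κ) (hμ : 0 < μ)
    (hm : 0 < m) : kappaMuShadowed gbar κ μ m = rlMeasure μ (shadowedSeries gbar κ μ m) := by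
  unfold kappaMuShadowed rlMeasure
  congr 1
  funext x
  rcases le_or_gt x 0 with hx | hx
  · simp [rlSeries_of_nonpos _ _ hx, kappaMuCondPDF, hx.not_gt]
  have hA : 0 ≤ μ * κ := by positivity
  have hβ : 0 < μ * (1 + κ) / gbar := by positivity
  have hk : ∀ j : ℕ, 0 ≤ (μ * (1 + κ) / gbar) ^ (μ + j) *
      (Real.exp (-(μ * (1 + κ) / gbar) * x) * rlKernel (μ + j) x) := fun j => by
    have h2 := rlKernel_nonneg (by positivity : 0 < μ + (j : ℝ)) x
    positivity
  have hw : ∀ (ξ : ℝ) (j : ℕ), 0 ≤ (ξ ^ 2 * (μ * κ)) ^ j / (j.factorial : ℝ) *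
      Real.exp (-(ξ ^ 2 * (μ * κ))) := fun ξ j => by positivity
  have hsum : ∀ ξ : ℝ, Summable fun j : ℕ => (ξ ^ 2 * (μ * κ)) ^ j / (j.factorial : ℝ) *
      Real.exp (-(ξ ^ 2 * (μ * κ))) * ((μ * (1 + κ) / gbar) ^ (μ + j) *
        (Real.exp (-(μ * (1 + κ) / gbar) * x) * rlKernel (μ + j) x)) := fun ξ => by
    refine ((summable_pow_mul_rlKernel hμ
      (by positivity : 0 ≤ ξ ^ 2 * (μ * κ) * (μ * (1 + κ) / gbar)) x).mul_left
      ((μ * (1 + κ) / gbar) ^ μ * Real.exp (-(μ * (1 + κ) / gbar) * x) *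
        Real.exp (-(ξ ^ 2 * (μ * κ))))).of_nonneg_of_le
      (fun j => mul_nonneg (hw ξ j) (hk j)) fun j => ?_
    have h2 := rlKernel_nonneg (by positivity : 0 < μ + (j : ℝ)) x
    rw [Real.rpow_add hβ, Real.rpow_natCast, mul_pow (ξ ^ 2 * (μ * κ))]
    calc _ = (1 / (j.factorial : ℝ)) * ((μ * (1 + κ) / gbar) ^ μ *
          Real.exp (-(μ * (1 + κ) / gbar) * x) * Real.exp (-(ξ ^ 2 * (μ * κ))) *
          ((ξ ^ 2 * (μ * κ)) ^ j * (μ * (1 + κ) / gbar) ^ j * rlKernel (μ + j) x)) := by ring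
      -- Dropping `1 / j!` is harmless: the kernels alone give convergence.
      _ ≤ 1 * _ := by
          gcongr
          rw [div_le_one (by positivity)]
          exact_mod_cast Nat.one_le_iff_ne_zero.2 (Nat.factorial_ne_zero j)
      _ = _ := one_mul _
  have heq : ∀ ξ ∈ Set.Ioi (0 : ℝ),
      ENNReal.ofReal (kappaMuCondPDF gbar κ μ ξ x) * ENNReal.ofReal (nakagamiPDF m ξ) =
      ∑' j : ℕ, ENNReal.ofReal ((μ * (1 + κ) / gbar) ^ (μ + j) *
        (Real.exp (-(μ * (1 + κ) / gbar) * x) * rlKernel (μ + j) x)) *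
        (ENNReal.ofReal ((ξ ^ 2 * (μ * κ)) ^ j / (j.factorial : ℝ) *
          Real.exp (-(ξ ^ 2 * (μ * κ)))) * ENNReal.ofReal (nakagamiPDF m ξ)) := by
    intro ξ hξ
    rw [kappaMuCondPDF_eq_tsum hg hκ hμ hξ hx,
      ENNReal.ofReal_tsum_of_nonneg (fun j => mul_nonneg (hw ξ j) (hk j)) (hsum ξ),
      ← ENNReal.tsum_mul_right]
    refine tsum_congr fun j => ?_
    rw [ENNReal.ofReal_mul (hw ξ j)]
    ring
  have hmeas : ∀ j : ℕ, Measurable fun ξ : ℝ => ENNReal.ofReal ((ξ ^ 2 * (μ * κ)) ^ j /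
      (j.factorial : ℝ) * Real.exp (-(ξ ^ 2 * (μ * κ)))) * ENNReal.ofReal (nakagamiPDF m ξ) :=
    fun j => Measurable.mul (by fun_prop) (measurable_nakagamiPDF m).ennreal_ofReal
  have hs := hasSum_shadowedSeries hg hκ hμ hm x
  have hc : ∀ j : ℕ, 0 ≤ (m / (μ * κ + m)) ^ m * coeff j (binom m (μ * κ / (μ * κ + m))) :=
    fun j => by
      have h1 := coeff_binom_nonneg hm (by positivity : 0 ≤ μ * κ / (μ * κ + m)) j
      positivity
  rw [setLIntegral_congr_fun measurableSet_Ioi heq,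
    lintegral_tsum fun j => ((hmeas j).const_mul _).aemeasurable, ← hs.tsum_eq,
    ENNReal.ofReal_tsum_of_nonneg (fun j => mul_nonneg (hc j) (hk j)) hs.summable]
  refine tsum_congr fun j => ?_
  rw [lintegral_const_mul _ (hmeas j), lintegral_poisson_nakagami hm hA, ENNReal.ofReal_mul (hc j),
    mul_comm]

/-! ### Sums of independent variables -/

theorem hasLaw_sum_rlMeasure {Ω ι : Type*} [MeasurableSpace Ω] {P : Measure Ω}
    [IsProbabilityMeasure P] {X : ι → Ω → ℝ} {μ : ι → ℝ} {a : ι → PowerSeries ℝ}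
    (hμ : ∀ k, 0 < μ k) (ha : ∀ k, GeomBound (a k)) (ha0 : ∀ k x, 0 ≤ rlSeries (μ k) (a k) x)
    (hlaw : ∀ k, HasLaw (X k) (rlMeasure (μ k) (a k)) P) (hindep : iIndepFun X P)
    {s : Finset ι} (hs : s.Nonempty) :
    (∀ x, 0 ≤ rlSeries (∑ k ∈ s, μ k) (∏ k ∈ s, a k) x) ∧
      HasLaw (fun ω => ∑ k ∈ s, X k ω) (rlMeasure (∑ k ∈ s, μ k) (∏ k ∈ s, a k)) P := by
  -- The induction starts at a singleton: the empty sum has law `δ_0`, which has no density, and the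
  -- convolution lemmas need positive order. Nonnegativity is carried along because each convolution
  -- step uses it.
  induction hs using Finset.Nonempty.cons_induction with
  | singleton k => simpa using ⟨ha0 k, hlaw k⟩
  | cons k s hk hs ih =>
    obtain ⟨h0, hl⟩ := ih
    have hS : 0 < ∑ k ∈ s, μ k := Finset.sum_pos (fun k _ => hμ k) hs
    have hA : GeomBound (∏ k ∈ s, a k) := GeomBound.prod s fun k _ => ha k
    simp_rw [Finset.sum_cons, Finset.prod_cons]
    refine ⟨rlSeries_conv_nonneg (hμ k) hS (ha k) hA (ha0 k) h0, ?_⟩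
    have := (hlaw k).isProbabilityMeasure_iff.1 inferInstance
    have := hl.isProbabilityMeasure_iff.1 inferInstance
    have hi : IndepFun (X k) (fun ω => ∑ k ∈ s, X k ω) P := by
      have h := (hindep.indepFun_finsetSum_of_notMem₀ (fun k => (hlaw k).aemeasurable) hk).symm
      have h' : (∑ j ∈ s, X j) = fun ω => ∑ k ∈ s, X k ω := by
        ext ω
        simp
      rwa [h'] at h
    rw [← rlMeasure_conv (hμ k) hS (ha k) hA (ha0 k) h0]
    exact hi.hasLaw_fun_add (hlaw k) hl

/-! ### Closed forms and the main theorem -/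

/-- The rates multiplying `x` in `sumArg`. -/
noncomputable def sumRate {ι : Type*} (gbar κ μ m : ι → ℝ) : ι ⊕ ι → ℝ :=
  Sum.elim (fun k => -(μ k * (1 + κ k)) / gbar k)
    (fun k => -(μ k * (1 + κ k)) / gbar k * (m k / (μ k * κ k + m k)))

theorem sumArg_eq {ι : Type*} (gbar κ μ m : ι → ℝ) (x : ℝ) :
    sumArg gbar κ μ m x = fun i => sumRate gbar κ μ m i * x := by
  funext i
  rcases i with k | k
  · simp only [sumArg, sumRate, Sum.elim_inl]
    ring
  · simp only [sumArg, sumRate, Sum.elim_inr]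
    ring

theorem prod_shadowedSeries {ι : Type*} [Fintype ι] (gbar κ μ m : ι → ℝ) :
    ∏ k, shadowedSeries (gbar k) (κ k) (μ k) (m k) = PowerSeries.C (sumConst gbar κ μ m) *
      ∏ i, binom (sumParam μ m i) (sumRate gbar κ μ m i) := by
  simp_rw [shadowedSeries]
  rw [Finset.prod_mul_distrib, ← map_prod, Fintype.prod_sum_type, ← Finset.prod_mul_distrib]
  rfl

theorem rlSeries_prod_shadowedSeries {ι : Type*} [Fintype ι] (gbar κ μ m : ι → ℝ) {c x : ℝ}
    (hc : 0 < c) (hx : 0 < x) :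
    rlSeries c (∏ k, shadowedSeries (gbar k) (κ k) (μ k) (m k)) x =
      (1 / Real.Gamma c) * sumConst gbar κ μ m * x ^ (c - 1) *
        phi2 (sumParam μ m) c (sumArg gbar κ μ m x) := by
  rw [prod_shadowedSeries, rlSeries_C_mul, rlSeries_prod_binom _ _ hc hx, sumArg_eq]
  ring

end KappaMu

theorem proposition1 {Ω : Type*} [MeasurableSpace Ω] (P : Measure Ω) [IsProbabilityMeasure P]
    (M : ℕ) (hM : 1 ≤ M) (gbar κ μ m : Fin M → ℝ)
    (hgbar : ∀ k, 0 < gbar k) (hκ : ∀ k, 0 ≤ κ k) (hμ : ∀ k, 0 < μ k) (hm : ∀ k, 0 < m k)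
    (X : Fin M → Ω → ℝ)
    (hlaw : ∀ k, HasLaw (X k) (KappaMu.kappaMuShadowed (gbar k) (κ k) (μ k) (m k)) P)
    (hindep : iIndepFun X P) :
    -- the series of the two `Φ₂` functions converge absolutely
    (∀ x : ℝ,
      Summable (KappaMu.phi2Term (KappaMu.sumParam μ m) (∑ k, μ k)
        (KappaMu.sumArg gbar κ μ m x)) ∧
      Summable (KappaMu.phi2Term (KappaMu.sumParam μ m) (1 + ∑ k, μ k)
        (KappaMu.sumArg gbar κ μ m x))) ∧
    -- the sum has the stated density on `(0, ∞)`, and density `0` elsewhere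
    (∀ x : ℝ, 0 < x → 0 ≤ KappaMu.sumPDF gbar κ μ m x) ∧
    HasLaw (fun ω => ∑ k, X k ω)
      (volume.withDensity fun x : ℝ =>
        ENNReal.ofReal (if 0 < x then KappaMu.sumPDF gbar κ μ m x else 0)) P ∧
    -- the sum has the stated cumulative distribution function on `[0, ∞)`, and `0` elsewhere
    (∀ x : ℝ, cdf (P.map fun ω => ∑ k, X k ω) x =
      if 0 ≤ x then KappaMu.sumCDF gbar κ μ m x else 0) := by
  have : NeZero M := ⟨by omega⟩
  have hS : 0 < ∑ k, μ k := Finset.sum_pos (fun k _ => hμ k) Finset.univ_nonempty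
  have ha : ∀ k, KappaMu.GeomBound (KappaMu.shadowedSeries (gbar k) (κ k) (μ k) (m k)) :=
    fun k => KappaMu.GeomBound.shadowedSeries _ _ _ _
  obtain ⟨h0, hl⟩ := KappaMu.hasLaw_sum_rlMeasure hμ ha
    (fun k => KappaMu.rlSeries_shadowedSeries_nonneg (hgbar k) (hκ k) (hμ k) (hm k))
    (fun k => KappaMu.kappaMuShadowed_eq (hgbar k) (hκ k) (hμ k) (hm k) ▸ hlaw k) hindep
    Finset.univ_nonempty
  have hpdf : ∀ x : ℝ, KappaMu.rlSeries (∑ k, μ k)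
      (∏ k, KappaMu.shadowedSeries (gbar k) (κ k) (μ k) (m k)) x =
      if 0 < x then KappaMu.sumPDF gbar κ μ m x else 0 := fun x => by
    split_ifs with hx
    · exact KappaMu.rlSeries_prod_shadowedSeries gbar κ μ m hS hx
    · exact KappaMu.rlSeries_of_nonpos _ _ (not_lt.1 hx)
  refine ⟨fun x => ⟨(KappaMu.hasSum_phi2Term _ hS _).summable,
    (KappaMu.hasSum_phi2Term _ (add_pos zero_lt_one hS) _).summable⟩, fun x hx => ?_, ?_,
    fun x => ?_⟩
  · have h := h0 x
    rwa [hpdf, if_pos hx] at h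
  · simp_rw [← hpdf]
    exact hl
  · have := (hl.isProbabilityMeasure_iff).1 inferInstance
    rw [hl.map_eq, cdf_eq_real, measureReal_def,
      KappaMu.rlMeasure_Iic hS (KappaMu.GeomBound.prod _ fun k _ => ha k) h0,
      ENNReal.toReal_ofReal (KappaMu.rlSeries_succ_nonneg hS
        (KappaMu.GeomBound.prod _ fun k _ => ha k) h0 x), add_comm]
    rcases lt_trichotomy x 0 with hx | rfl | hx
    · rw [if_neg hx.not_ge, KappaMu.rlSeries_of_nonpos _ _ hx.le]
    -- At the origin the closed form also vanishes, since `0 ^ S = 0` for `S > 0`.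
    · rw [if_pos le_rfl, KappaMu.rlSeries_of_nonpos _ _ le_rfl, KappaMu.sumCDF,
        Real.zero_rpow hS.ne']
      simp
    · rw [if_pos hx.le, KappaMu.rlSeries_prod_shadowedSeries gbar κ μ m (by positivity) hx,
        KappaMu.sumCDF, add_sub_cancel_left]
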